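/- Let $q(x)=x^TQx+2c^Tx$ with $Q\in\mathbb{R}^{n\times n}$ symmetric and $c\in\mathbb{R}^n$, let $A\in\mathbb{R}^{m\times n}$, $b\in\mathbb{R}^m$, and let $$S=\{x\in\mathbb{R}^n: Ax=b,\ x\ge 0\},\qquad \ell^*=\inf_{x\in S}q(x)\in[-\infty,+\infty],\qquad S^*=\{x\in S: q(x)=\ell^*\}.$$ Assume that $S\neq\emptyset$ ($S$ may be bounded or unbounded) and that $L_\infty=\{d\in\mathbb{R}^n: Ad=0,\ d\ge 0,\ d^TQd<0\}$ is empty. Let $\mathcal{CP}^{n+1}$ be the cone of matrices $\sum_{j=1}^k y^j(y^j)^T$ with $y^j\in\mathbb{R}^{n+1}$, $y^j\ge 0$, and $\mathcal{D}^{n+1}$ the cone of positive semidefinite, componentwise nonnegative symmetric matrices of order $n+1$; rows and columns are indexed by $0,1,\dots,n$. Let $\mathcal{K}$ be a closed convex cone with $\mathcal{CP}^{n+1}\subseteq\mathcal{K}\subseteq\mathcal{D}^{n+1}$. With $\langle U,V\rangle=\sum_{i,j}U_{ij}V_{ij}$ and $$\widehat Q=\begin{bmatrix}0&c^T\\c&Q\end{bmatrix},\qquad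 \widehat A=\begin{bmatrix}b^Tb&-b^TA\\-A^Tb&A^TA\end{bmatrix},$$ put $$\ell_{\mathcal K}=\inf\{\langle\widehat Q,Y\rangle:\ \langle\widehat A,Y\rangle=0,\ Y_{00}=1,\ Y\in\mathcal K\},$$ and, for $\tilde x\in\mathbb{R}^n$, let $\ell_{\mathcal K}(\tilde x)$ be the optimal value of the problem $P(\mathcal K,\tilde x)$ obtained by adding the constraint $Y_{0,1:n}=\tilde x$ (infima over the empty set are $+\infty$). A convex underestimator of $q$ on $S$ is a function $g:\mathbb{R}^n\to[-\infty,+\infty]$ with convex epigraph $\{(x,r)\in\mathbb{R}^n\times\mathbb{R}: g(x)\le r\}$ and $g(x)\le q(x)$ for all $x\in S$; the convex envelope $f_S$ of $q$ on $S$ is the pointwise supremum of all convex underestimators of $q$ on $S$. Suppose that either $n\le 3$, or $n=4$ and there exists $y\in\mathbb{R}^m$ with $A^Ty\ge 0$ and $b^Ty=1$. Then: 1. $\ell_{\mathcal K}(x)=f_S(x)$ for every $x\in S$; 2. $\ell_{\mathcal K}=\ell^*$; 3. for every $\tilde x\in\mathbb{R}^n$: $\ell_{\mathcal K}(\tilde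 x)=\ell^*$ and the value $\ell_{\mathcal K}(\tilde x)$ is attained by a feasible solution of $P(\mathcal K,\tilde x)$ if and only if $\tilde x\in\operatorname{conv}(S^*)$. -/

import Mathlib

open Matrix

noncomputable section

/-- The data of a quadratic program: minimize `xᵀ Q x + 2 cᵀ x` subject to `A x = b`, `x ≥ 0`,
with `n` variables, `m` equality constraints, and a symmetric matrix `Q`. -/
structure QP (m n : ℕ) where
  Q : Matrix (Fin n) (Fin n) ℝ
  Q_symm : Q.IsSymm
  c : Fin n → ℝ
  A : Matrix (Fin m) (Fin n) ℝ
  b : Fin m → ℝ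

/-- The matrix `[[t, vᵀ], [v, M]]`, with rows and columns indexed by `0, 1, …, n`. -/
def bordered {n : ℕ} (t : ℝ) (v : Fin n → ℝ) (M : Matrix (Fin n) (Fin n) ℝ) :
    Matrix (Fin (n + 1)) (Fin (n + 1)) ℝ :=
  Matrix.of (Fin.cons (Fin.cons t v) (fun i => Fin.cons (v i) (M i)))

/-- The trace inner product of two matrices. -/
def traceInner {N : ℕ} (U V : Matrix (Fin N) (Fin N) ℝ) : ℝ :=
  ∑ i, ∑ j, U i j * V i j

/-- Completely positive matrices. -/
def cpCone (N : ℕ) : Set (Matrix (Fin N) (Fin N) ℝ) :=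
  {Y | ∃ (k : ℕ) (y : Fin k → Fin N → ℝ),
    (∀ j, 0 ≤ y j) ∧ Y = ∑ j, Matrix.vecMulVec (y j) (y j)}

/-- Doubly nonnegative matrices. -/
def dnnCone (N : ℕ) : Set (Matrix (Fin N) (Fin N) ℝ) :=
  {Y | Y.PosSemidef ∧ ∀ i j, 0 ≤ Y i j}

/-- Closed convex cones between the completely positive and the doubly nonnegative matrices
of order `n + 1`. -/
def coneFamilyStar (n : ℕ) : Set (ConvexCone ℝ (Matrix (Fin (n + 1)) (Fin (n + 1)) ℝ)) :=
  {K | IsClosed (K : Set (Matrix (Fin (n + 1)) (Fin (n + 1)) ℝ)) ∧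
    cpCone (n + 1) ⊆ (K : Set (Matrix (Fin (n + 1)) (Fin (n + 1)) ℝ)) ∧
    (K : Set (Matrix (Fin (n + 1)) (Fin (n + 1)) ℝ)) ⊆ dnnCone (n + 1)}

/-- Convexity of an extended-real-valued function: its epigraph is convex. -/
def IsConvexFun {n : ℕ} (g : (Fin n → ℝ) → EReal) : Prop :=
  Convex ℝ {p : (Fin n → ℝ) × ℝ | g p.1 ≤ (p.2 : EReal)}

namespace QP

variable {m n : ℕ} (P : QP m n)

/-- The objective function `q(x) = xᵀ Q x + 2 cᵀ x`. -/
def obj (x : Fin n → ℝ) : ℝ := x ⬝ᵥ (P.Q *ᵥ x) + 2 * (P.c ⬝ᵥ x)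

/-- The feasible region `S`. -/
def feasible : Set (Fin n → ℝ) := {x | P.A *ᵥ x = P.b ∧ 0 ≤ x}

/-- The recession directions of `S` of negative curvature. -/
def negCurvature : Set (Fin n → ℝ) :=
  {d | P.A *ᵥ d = 0 ∧ 0 ≤ d ∧ d ⬝ᵥ (P.Q *ᵥ d) < 0}

/-- The optimal value (`⊤` if infeasible, `⊥` if unbounded below). -/
def optVal : EReal := ⨅ x ∈ P.feasible, (P.obj x : EReal)

/-- The set of optimal solutions. -/
def optSet : Set (Fin n → ℝ) := {x | x ∈ P.feasible ∧ (P.obj x : EReal) = P.optVal}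

/-- `g` is a convex underestimator of the objective on the feasible region. -/
def IsConvexUnderestimator (g : (Fin n → ℝ) → EReal) : Prop :=
  IsConvexFun g ∧ ∀ x ∈ P.feasible, g x ≤ (P.obj x : EReal)

/-- The convex envelope of the objective on the feasible region: the pointwise supremum of all
convex underestimators. -/
def convexEnvelope (x : Fin n → ℝ) : EReal :=
  ⨆ g ∈ {g : (Fin n → ℝ) → EReal | P.IsConvexUnderestimator g}, g x

/-- The matrix `[[0, cᵀ], [c, Q]]`. -/
def Qhat : Matrix (Fin (n + 1)) (Fin (n + 1)) ℝ := bordered 0 P.c P.Q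

/-- The matrix `[[bᵀ b, -bᵀ A], [-Aᵀ b, Aᵀ A]]`. -/
def Ahat : Matrix (Fin (n + 1)) (Fin (n + 1)) ℝ :=
  bordered (P.b ⬝ᵥ P.b) (-(P.Aᵀ *ᵥ P.b)) (P.Aᵀ * P.A)

/-- The feasible region of the conic relaxation given by the cone `K`. -/
def relaxFeasible (K : ConvexCone ℝ (Matrix (Fin (n + 1)) (Fin (n + 1)) ℝ)) :
    Set (Matrix (Fin (n + 1)) (Fin (n + 1)) ℝ) :=
  {Y | traceInner P.Ahat Y = 0 ∧ Y 0 0 = 1 ∧ Y ∈ K}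

/-- The optimal value `ℓ_K` of the conic relaxation. -/
def relaxVal (K : ConvexCone ℝ (Matrix (Fin (n + 1)) (Fin (n + 1)) ℝ)) : EReal :=
  ⨅ Y ∈ P.relaxFeasible K, (traceInner P.Qhat Y : EReal)

/-- The feasible region of the conic relaxation with the additional constraint `Y_{0,1:n} = x`. -/
def relaxFeasibleAt (K : ConvexCone ℝ (Matrix (Fin (n + 1)) (Fin (n + 1)) ℝ))
    (x : Fin n → ℝ) : Set (Matrix (Fin (n + 1)) (Fin (n + 1)) ℝ) :=
  {Y | Y ∈ P.relaxFeasible K ∧ ∀ j : Fin n, Y 0 j.succ = x j}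

/-- The underestimator `ℓ_K(x)`. -/
def relaxValAt (K : ConvexCone ℝ (Matrix (Fin (n + 1)) (Fin (n + 1)) ℝ))
    (x : Fin n → ℝ) : EReal :=
  ⨅ Y ∈ P.relaxFeasibleAt K x, (traceInner P.Qhat Y : EReal)

/-- The value `ℓ_K(x)` is attained by some feasible matrix. -/
def RelaxAttainedAt (K : ConvexCone ℝ (Matrix (Fin (n + 1)) (Fin (n + 1)) ℝ))
    (x : Fin n → ℝ) : Prop :=
  ∃ Y ∈ P.relaxFeasibleAt K x, (traceInner P.Qhat Y : EReal) = P.relaxValAt K x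

end QP

end

/-!
Every relaxation in the family coincides with the completely positive one. For `n ≤ 3` this is the
equality of the doubly nonnegative and the completely positive cones in order at most four
(`dnnCone_subset_cpCone`). For `n = 4`, the equation `⟨Â, Y⟩ = 0` puts every row of `[b, -A]` into
the kernel of `Y`, so a vector `y` with `Aᵀ y ≥ 0` and `bᵀ y = 1` expresses row `0` of `Y` as a
nonnegative combination of the other rows, and complete positivity is inherited from the principal
submatrix of order four (`QP.mem_cpCone_of_dual_certificate`).

Let `Y = ∑ (t_j, z_j)(t_j, z_j)ᵀ` be feasible with `t_j, z_j ≥ 0`. Then `A z_j = t_j b`. The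
generators with `t_j > 0` are multiples of lifted points `z_j / t_j` of the feasible region, with
weights `t_j²` summing to `1`. Those with `t_j = 0` are recession directions, which by assumption
have nonnegative curvature. So `⟨Q̂, Y⟩` is at least a convex combination of values of the objective
at feasible points whose barycentre is `Y_{0,1:n}` (`QP.exists_convex_combination`). This bounds
the relaxation below by every convex underestimator and forces the points carrying an optimal `Y`
to be optimal. Conversely, `ℓ_K(·)` is itself a convex underestimator, since lifted feasible points
are feasible for the relaxation and the constraints are convex.

For the equality of the cones, subtract from a doubly nonnegative matrix, positive on its
support, the largest multiple of `(A e_i)(A e_i)ᵀ` that keeps it nonnegative. This preserves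
semidefiniteness and creates a zero (`exists_dnnCone_sub_with_zero`). A matrix with an off-diagonal zero at `(p, q)` is
split along its Schur complement on the remaining at most two indices into matrices that no longer
involve `q`, respectively `p` (`exists_dnnCone_split`). Induction on the support concludes.
-/

/-! ### Completely positive matrices -/

theorem vecMulVec_mem_cpCone {N : ℕ} {v : Fin N → ℝ} (hv : 0 ≤ v) : vecMulVec v v ∈ cpCone N :=
  ⟨1, fun _ => v, fun _ => hv, by simp⟩

theorem zero_mem_cpCone (N : ℕ) : (0 : Matrix (Fin N) (Fin N) ℝ) ∈ cpCone N :=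
  ⟨0, fun _ => 0, fun _ => le_rfl, by simp⟩

theorem add_mem_cpCone {N : ℕ} {Y Z : Matrix (Fin N) (Fin N) ℝ} (hY : Y ∈ cpCone N)
    (hZ : Z ∈ cpCone N) : Y + Z ∈ cpCone N := by
  obtain ⟨k, y, hy, rfl⟩ := hY
  obtain ⟨l, z, hz, rfl⟩ := hZ
  refine ⟨k + l, Fin.append y z, fun j => ?_, by simp [Fin.sum_univ_add]⟩
  refine Fin.addCases (fun i => ?_) (fun i => ?_) j
  · simpa using hy i
  · simpa using hz i

theorem smul_mem_cpCone {N : ℕ} {Y : Matrix (Fin N) (Fin N) ℝ} (hY : Y ∈ cpCone N) {t : ℝ}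
    (ht : 0 ≤ t) : t • Y ∈ cpCone N := by
  obtain ⟨k, y, hy, rfl⟩ := hY
  refine ⟨k, fun j => √t • y j, fun j => smul_nonneg (Real.sqrt_nonneg _) (hy j), ?_⟩
  simp [Finset.smul_sum, vecMulVec_smul, smul_vecMulVec, smul_smul, Real.mul_self_sqrt ht]

/-- Congruence by an entrywise nonnegative matrix preserves complete positivity. -/
theorem mul_mul_transpose_mem_cpCone {M N : ℕ} {Y : Matrix (Fin N) (Fin N) ℝ} (hY : Y ∈ cpCone N)
    {L : Matrix (Fin M) (Fin N) ℝ} (hL : ∀ i j, 0 ≤ L i j) : L * Y * Lᵀ ∈ cpCone M := by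
  obtain ⟨k, y, hy, rfl⟩ := hY
  have h : ∀ j, 0 ≤ L *ᵥ y j := fun j i => by
    change 0 ≤ ∑ l, L i l * y j l
    exact Finset.sum_nonneg fun l _ => mul_nonneg (hL i l) (hy j l)
  refine ⟨k, fun j => L *ᵥ y j, h, ?_⟩
  simp [Matrix.mul_sum, Matrix.sum_mul, mul_vecMulVec, vecMulVec_mul, vecMul_transpose]

/-! ### Positive semidefinite matrices -/

theorem Matrix.PosSemidef.apply_comm {ι : Type*} {A : Matrix ι ι ℝ} (hA : A.PosSemidef)
    (i j : ι) : A i j = A j i := by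
  simpa using (hA.isHermitian.apply i j).symm

section

variable {ι : Type*} [Fintype ι] {A : Matrix ι ι ℝ}

theorem Matrix.PosSemidef.dotProduct_nonneg (hA : A.PosSemidef) (x : ι → ℝ) :
    0 ≤ x ⬝ᵥ (A *ᵥ x) := by
  simpa using hA.dotProduct_mulVec_nonneg x

theorem Matrix.PosSemidef.row_eq_zero (hA : A.PosSemidef) {p : ι} (hp : A p p = 0) : A p = 0 := by
  classical
  have h := (hA.dotProduct_mulVec_zero_iff (Pi.single p 1)).1 (by simp [hp])
  ext j
  have := congrFun h j
  rw [hA.apply_comm]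
  simpa using this

/-- At `t = (A p p)⁻¹` the matrix is the Schur complement of `A p p`, bordered by zeros. If
`A p p = 0` then row `p` vanishes, and the junk value `0⁻¹ = 0` does no harm. -/
theorem Matrix.PosSemidef.sub_smul_vecMulVec_row (hA : A.PosSemidef) (p : ι) {t : ℝ}
    (ht : t ≤ (A p p)⁻¹) : (A - t • vecMulVec (A p) (A p)).PosSemidef := by
  classical
  rcases eq_or_ne (A p p) 0 with h0 | h0
  · simpa [hA.row_eq_zero h0] using hA
  have hpos : 0 < A p p := lt_of_le_of_ne hA.diag_nonneg h0.symm
  refine .of_dotProduct_mulVec_nonneg ?_ fun x => ?_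
  · ext i j
    simp [vecMulVec_apply, hA.apply_comm i j, mul_comm]
  set s := A p ⬝ᵥ x with hs
  have hcol : A *ᵥ Pi.single p 1 = A p := by
    ext j
    simp [hA.apply_comm j p]
  have hcs : x ⬝ᵥ A p = s := dotProduct_comm _ _
  -- The form is evaluated at the point of `x + ℝ e_p` where it is smallest.
  have h := hA.dotProduct_nonneg (x - (s / A p p) • Pi.single p 1)
  have he : Pi.single p 1 ⬝ᵥ (A *ᵥ x) = s := by simp [hs, mulVec]
  rw [mulVec_sub, mulVec_smul, hcol, sub_dotProduct, dotProduct_sub, dotProduct_sub,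
    smul_dotProduct, smul_dotProduct, dotProduct_smul, dotProduct_smul, he, hcs] at h
  simp only [single_dotProduct, one_mul, smul_eq_mul] at h
  have h2 : s / A p p * A p p = s := div_mul_cancel₀ _ h0
  have h3 : s / A p p * s = (A p p)⁻¹ * s ^ 2 := by ring
  have h4 : t * s ^ 2 ≤ (A p p)⁻¹ * s ^ 2 := by gcongr
  have h5 : star x ⬝ᵥ ((A - t • vecMulVec (A p) (A p)) *ᵥ x) = x ⬝ᵥ (A *ᵥ x) - t * s ^ 2 := by
    simp [sub_mulVec, smul_mulVec, vecMulVec_mulVec, hcs, ← hs, pow_two]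
  rw [h5]
  rw [h2, h3] at h
  linarith

end

/-! ### Doubly nonnegative matrices of order at most four -/

theorem mem_dnnCone_smul_vecMulVec_add {N : ℕ} {v : Fin N → ℝ} {M : Matrix (Fin N) (Fin N) ℝ}
    (hM : M.PosSemidef) {a t : ℝ} (ha : 0 ≤ a) (ht : 0 ≤ t)
    (h : ∀ i j, 0 ≤ a * (v i * v j) + t * M i j) :
    a • vecMulVec v v + t • M ∈ dnnCone N := by
  refine ⟨.add (.smul ?_ ha) (hM.smul ht), fun i j => by simpa [vecMulVec_apply] using h i j⟩
  simpa using posSemidef_vecMulVec_self_star v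

/-- A doubly nonnegative matrix of order at most four with an off-diagonal zero at `(p, q)` is a
sum of two doubly nonnegative matrices, of which one has row `q` zero and the other row `p`. -/
theorem exists_dnnCone_split {N : ℕ} (hN : N ≤ 4) {A : Matrix (Fin N) (Fin N) ℝ}
    (hA : A ∈ dnnCone N) {p q : Fin N} (hpq : p ≠ q) (h0 : A p q = 0) :
    ∃ B ∈ dnnCone N, ∃ C ∈ dnnCone N, A = B + C ∧ B q q = 0 ∧ C p p = 0 := by
  obtain ⟨hA, hA0⟩ := hA
  have h0' : A q p = 0 := by rw [hA.apply_comm, h0]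
  set α := (A p p)⁻¹ with hα
  set β := (A q q)⁻¹ with hβ
  have hα0 : 0 ≤ α := inv_nonneg.2 (hA0 p p)
  have hβ0 : 0 ≤ β := inv_nonneg.2 (hA0 q q)
  set A' := A - α • vecMulVec (A p) (A p) with hA'
  have hA'psd : A'.PosSemidef := hA.sub_smul_vecMulVec_row p le_rfl
  have hrow : A' q = A q := by
    ext j
    simp [hA', vecMulVec_apply, h0]
  -- `M` is the Schur complement of the block `{p, q}`, bordered by zeros.
  set M := A' - β • vecMulVec (A q) (A q) with hM
  have hMpsd : M.PosSemidef := by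
    have := hA'psd.sub_smul_vecMulVec_row q (t := β) (by rw [hrow])
    rwa [hrow] at this
  have hMij : ∀ i j, M i j = A i j - α * (A p i * A p j) - β * (A q i * A q j) := fun i j => by
    simp [hM, hA', vecMulVec_apply]
  have hMp : ∀ j, M p j = 0 := fun j => by
    rw [hMij, h0']
    rcases eq_or_ne (A p p) 0 with h | h
    · simp [hA.row_eq_zero h]
    · rw [hα]
      field_simp
      ring
  have hMq : ∀ j, M q j = 0 := fun j => by
    rw [hMij, h0]
    rcases eq_or_ne (A q q) 0 with h | h
    · simp [hA.row_eq_zero h]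
    · rw [hβ]
      field_simp
      ring
  -- At most one off-diagonal position `{r, s}` of `M` is nonzero, and `l` distributes it.
  obtain ⟨l, hl0, hl1, hl⟩ : ∃ l : ℝ, 0 ≤ l ∧ l ≤ 1 ∧
      ∀ i j, i ≠ j → i ≠ p → i ≠ q → j ≠ p → j ≠ q →
        0 ≤ α * (A p i * A p j) + l * M i j ∧ 0 ≤ β * (A q i * A q j) + (1 - l) * M i j := by
    by_cases hex : ∃ r s : Fin N, r ≠ s ∧ r ≠ p ∧ r ≠ q ∧ s ≠ p ∧ s ≠ q
    · obtain ⟨r, s, hrs, hrp, hrq, hsp, hsq⟩ := hex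
      have hmem : ∀ i, i ≠ p → i ≠ q → i = r ∨ i = s := by
        intro i hip hiq
        by_contra! hi
        have h5 : ({p, q, r, s, i} : Finset (Fin N)).card = 5 := by
          rw [Finset.card_insert_of_notMem, Finset.card_insert_of_notMem,
            Finset.card_insert_of_notMem, Finset.card_pair] <;> grind
        have := Finset.card_le_univ ({p, q, r, s, i} : Finset (Fin N))
        rw [h5, Fintype.card_fin] at this
        omega
      set a := α * (A p r * A p s) with ha
      set b := β * (A q r * A q s) with hb
      have ha0 : 0 ≤ a := mul_nonneg hα0 (mul_nonneg (hA0 _ _) (hA0 _ _))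
      have hb0 : 0 ≤ b := mul_nonneg hβ0 (mul_nonneg (hA0 _ _) (hA0 _ _))
      have hrs' : M r s = A r s - a - b := hMij r s
      obtain ⟨l, hl0, hl1, hla⟩ : ∃ l : ℝ, 0 ≤ l ∧ l ≤ 1 ∧ l * (a + b) = a := by
        rcases eq_or_ne (a + b) 0 with hab | hab
        · exact ⟨0, le_rfl, zero_le_one, by linarith⟩
        · exact ⟨a / (a + b), by positivity, div_le_one_of_le₀ (by linarith) (by linarith),
            div_mul_cancel₀ _ hab⟩
      -- With this choice the two entries are `l * A r s` and `(1 - l) * A r s`.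
      have key : 0 ≤ a + l * M r s ∧ 0 ≤ b + (1 - l) * M r s := by
        have h1 : a + l * M r s = l * A r s := by rw [hrs']; linear_combination -hla
        have h2 : b + (1 - l) * M r s = (1 - l) * A r s := by rw [hrs']; linear_combination hla
        rw [h1, h2]
        exact ⟨mul_nonneg hl0 (hA0 _ _), mul_nonneg (by linarith) (hA0 _ _)⟩
      refine ⟨l, hl0, hl1, fun i j hij hip hiq hjp hjq => ?_⟩
      rcases hmem i hip hiq with rfl | rfl <;> rcases hmem j hjp hjq with rfl | rfl
      · exact absurd rfl hij
      · exact key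
      · rw [hMpsd.apply_comm, mul_comm (A p i), mul_comm (A q i)]
        exact key
      · exact absurd rfl hij
    · push Not at hex
      exact ⟨0, le_rfl, zero_le_one, fun i j hij hip hiq hjp hjq =>
        absurd (hex i j hij hip hiq hjp) hjq⟩
  have hnn : ∀ i j, 0 ≤ α * (A p i * A p j) + l * M i j ∧
      0 ≤ β * (A q i * A q j) + (1 - l) * M i j := by
    intro i j
    have hp0 : 0 ≤ α * (A p i * A p j) := mul_nonneg hα0 (mul_nonneg (hA0 _ _) (hA0 _ _))
    have hq0 : 0 ≤ β * (A q i * A q j) := mul_nonneg hβ0 (mul_nonneg (hA0 _ _) (hA0 _ _))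
    by_cases hM0 : 0 ≤ M i j
    · exact ⟨add_nonneg hp0 (mul_nonneg hl0 hM0),
        add_nonneg hq0 (mul_nonneg (by linarith) hM0)⟩
    · refine hl i j ?_ ?_ ?_ ?_ ?_ <;> rintro rfl <;> apply hM0
      · exact hMpsd.diag_nonneg
      · exact (hMp j).ge
      · exact (hMq j).ge
      · rw [hMpsd.apply_comm]; exact (hMp i).ge
      · rw [hMpsd.apply_comm]; exact (hMq i).ge
  refine ⟨α • vecMulVec (A p) (A p) + l • M,
    mem_dnnCone_smul_vecMulVec_add hMpsd hα0 hl0 fun i j => (hnn i j).1,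
    β • vecMulVec (A q) (A q) + (1 - l) • M,
    mem_dnnCone_smul_vecMulVec_add hMpsd hβ0 (by linarith) fun i j => (hnn i j).2, ?_, ?_, ?_⟩
  · ext i j
    simp [vecMulVec_apply, hMij]
    ring
  · simp [vecMulVec_apply, h0, hMq]
  · simp [vecMulVec_apply, h0', hMp]

/-- Subtracting the largest possible multiple of `vecMulVec (A i) (A i)` from a doubly nonnegative
matrix creates a zero entry before semidefiniteness is lost, since at the Schur complement the
diagonal entry `(i, i)` has become zero. -/
theorem exists_dnnCone_sub_with_zero {N : ℕ} {A : Matrix (Fin N) (Fin N) ℝ} (hA : A ∈ dnnCone N)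
    {s : Finset (Fin N)} (hs : s.Nonempty) (hsupp : ∀ i ∉ s, A i i = 0)
    (hpos : ∀ i ∈ s, ∀ j ∈ s, 0 < A i j) :
    ∃ B ∈ cpCone N, ∃ C ∈ dnnCone N, A = B + C ∧ (∀ i ∉ s, C i i = 0) ∧
      ∃ j ∈ s, ∃ k ∈ s, C j k = 0 := by
  obtain ⟨hA, hA0⟩ := hA
  obtain ⟨i, hi⟩ := hs
  obtain ⟨⟨j, k⟩, hjk, hmin⟩ := Finset.exists_min_image (s ×ˢ s)
    (fun x => A x.1 x.2 / (A i x.1 * A i x.2)) ⟨(i, i), by simp [hi]⟩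
  obtain ⟨hj, hk⟩ := Finset.mem_product.1 hjk
  set t := A j k / (A i j * A i k) with ht
  have ht0 : 0 ≤ t := div_nonneg (hA0 _ _) (mul_nonneg (hA0 _ _) (hA0 _ _))
  have htle : t ≤ (A i i)⁻¹ := by
    have h : t ≤ A i i / (A i i * A i i) := hmin (i, i) (by simp [hi])
    rwa [div_mul_cancel_left₀ (hpos i hi i hi).ne'] at h
  have hrow : ∀ p ∉ s, A p = 0 := fun p hp => hA.row_eq_zero (hsupp p hp)
  refine ⟨t • vecMulVec (A i) (A i), smul_mem_cpCone (vecMulVec_mem_cpCone fun p => hA0 i p) ht0,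
    A - t • vecMulVec (A i) (A i), ⟨hA.sub_smul_vecMulVec_row i htle, fun p q => ?_⟩,
    by abel, fun p hp => ?_, j, hj, k, hk, ?_⟩
  · by_cases hp : p ∈ s
    · by_cases hq : q ∈ s
      · have h : t ≤ A p q / (A i p * A i q) := hmin (p, q) (by simp [hp, hq])
        rw [le_div_iff₀ (mul_pos (hpos i hi p hp) (hpos i hi q hq))] at h
        simpa [vecMulVec_apply] using h
      · have h1 : A i q = 0 := by rw [hA.apply_comm, hrow q hq]; rfl
        have h2 : A p q = 0 := by rw [hA.apply_comm, hrow q hq]; rfl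
        simp [vecMulVec_apply, h1, h2]
    · have h1 : A i p = 0 := by rw [hA.apply_comm, hrow p hp]; rfl
      have h2 : A p q = 0 := by rw [hrow p hp]; rfl
      simp [vecMulVec_apply, h1, h2]
  · have h1 : A i p = 0 := by rw [hA.apply_comm, hrow p hp]; rfl
    simp [vecMulVec_apply, h1, hsupp p hp]
  · have := (mul_pos (hpos i hi j hj) (hpos i hi k hk)).ne'
    simp only [Matrix.sub_apply, Matrix.smul_apply, vecMulVec_apply, smul_eq_mul]
    rw [ht, div_mul_cancel₀ _ this, sub_self]

/-- Doubly nonnegative matrices of order at most four are completely positive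
(Maxfield and Minc). -/
theorem dnnCone_subset_cpCone {N : ℕ} (hN : N ≤ 4) : dnnCone N ⊆ cpCone N := by
  suffices H : ∀ s : Finset (Fin N), ∀ A ∈ dnnCone N, (∀ i ∉ s, A i i = 0) → A ∈ cpCone N from
    fun A hA => H Finset.univ A hA (by simp)
  intro s
  induction s using Finset.strongInduction with
  | H s ih =>
    have hdiag : ∀ A ∈ dnnCone N, (∀ i ∉ s, A i i = 0) → ∀ p ∈ s, A p p = 0 → A ∈ cpCone N := by
      intro A hA hs p hp h0
      refine ih _ (Finset.erase_ssubset hp) A hA fun i hi => ?_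
      by_cases h : i = p
      · rw [h, h0]
      · exact hs i fun h' => hi (Finset.mem_erase.2 ⟨h, h'⟩)
    have hzero : ∀ A ∈ dnnCone N, (∀ i ∉ s, A i i = 0) → ∀ p ∈ s, ∀ q ∈ s, A p q = 0 →
        A ∈ cpCone N := by
      intro A hA hs p hp q hq h0
      rcases eq_or_ne p q with rfl | hpq
      · exact hdiag A hA hs p hp h0
      obtain ⟨B, hB, C, hC, rfl, hBq, hCp⟩ := exists_dnnCone_split hN hA hpq h0
      have h : ∀ i ∉ s, B i i = 0 ∧ C i i = 0 := fun i hi =>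
        (add_eq_zero_iff_of_nonneg (hB.2 i i) (hC.2 i i)).1 (hs i hi)
      exact add_mem_cpCone (hdiag B hB (fun i hi => (h i hi).1) q hq hBq)
        (hdiag C hC (fun i hi => (h i hi).2) p hp hCp)
    intro A hA hs
    by_cases h : ∃ p ∈ s, ∃ q ∈ s, A p q = 0
    · obtain ⟨p, hp, q, hq, h0⟩ := h
      exact hzero A hA hs p hp q hq h0
    push Not at h
    rcases s.eq_empty_or_nonempty with rfl | hne
    · have : A = 0 := by
        ext i j
        rw [hA.1.row_eq_zero (hs i (by simp))]
        rfl
      exact this ▸ zero_mem_cpCone N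
    · obtain ⟨B, hB, C, hC, rfl, hCs, j, hj, k, hk, h0⟩ := exists_dnnCone_sub_with_zero hA hne hs
        fun i hi j hj => lt_of_le_of_ne (hA.2 i j) (h i hi j hj).symm
      exact add_mem_cpCone hB (hzero C hC hCs j hj k hk h0)

/-! ### The trace inner product -/

theorem traceInner_add {N : ℕ} (U V W : Matrix (Fin N) (Fin N) ℝ) :
    traceInner U (V + W) = traceInner U V + traceInner U W := by
  simp [traceInner, mul_add, Finset.sum_add_distrib]

theorem traceInner_smul {N : ℕ} (U V : Matrix (Fin N) (Fin N) ℝ) (t : ℝ) :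
    traceInner U (t • V) = t * traceInner U V := by
  simp [traceInner, Finset.mul_sum, mul_left_comm]

theorem traceInner_sum {N : ℕ} {ι : Type*} (s : Finset ι) (U : Matrix (Fin N) (Fin N) ℝ)
    (V : ι → Matrix (Fin N) (Fin N) ℝ) :
    traceInner U (∑ i ∈ s, V i) = ∑ i ∈ s, traceInner U (V i) := by
  classical
  induction s using Finset.induction_on with
  | empty => simp [traceInner]
  | insert a s ha ih => rw [Finset.sum_insert ha, Finset.sum_insert ha, traceInner_add, ih]

theorem traceInner_bordered_vecMulVec {n : ℕ} (s t : ℝ) (v z : Fin n → ℝ)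
    (M : Matrix (Fin n) (Fin n) ℝ) :
    traceInner (bordered s v M) (vecMulVec (Fin.cons t z) (Fin.cons t z)) =
      s * t ^ 2 + 2 * t * (v ⬝ᵥ z) + z ⬝ᵥ (M *ᵥ z) := by
  have h1 : ∑ j, v j * (t * z j) = t * (v ⬝ᵥ z) := by
    simp [dotProduct, Finset.mul_sum, mul_left_comm]
  have h2 : ∑ i, v i * (z i * t) = t * (v ⬝ᵥ z) := by
    rw [← h1]
    simp only [mul_comm t]
  have h3 : ∑ i, ∑ j, M i j * (z i * z j) = z ⬝ᵥ (M *ᵥ z) := by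
    simp [dotProduct, mulVec, Finset.mul_sum, mul_left_comm]
  simp only [traceInner, bordered, vecMulVec_apply, Fin.sum_univ_succ, of_apply, Fin.cons_zero,
    Fin.cons_succ, Finset.sum_add_distrib, h1, h2, h3]
  ring

namespace QP

variable {m n : ℕ} (P : QP m n)

/-! ### The linear constraints in the lifted space -/

/-- The `i`-th row of the matrix `[b, -A]`, which defines the homogenized constraint
`t b_i - (A z)_i = 0` on `(t, z)`. -/
def constraintRow (i : Fin m) : Fin (n + 1) → ℝ := Fin.cons (P.b i) (-(P.A i))

theorem Ahat_apply (k l : Fin (n + 1)) :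
    P.Ahat k l = ∑ i, P.constraintRow i k * P.constraintRow i l := by
  refine Fin.cases ?_ (fun k => ?_) k <;> refine Fin.cases ?_ (fun l => ?_) l <;>
    simp [Ahat, bordered, constraintRow, dotProduct, mulVec, mul_apply, mul_comm]

theorem traceInner_Ahat (Y : Matrix (Fin (n + 1)) (Fin (n + 1)) ℝ) :
    traceInner P.Ahat Y = ∑ i, P.constraintRow i ⬝ᵥ (Y *ᵥ P.constraintRow i) := by
  simp only [traceInner, Ahat_apply, dotProduct, mulVec, Finset.sum_mul, Finset.mul_sum]
  conv_rhs => rw [Finset.sum_comm]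
  refine Finset.sum_congr rfl fun k _ => ?_
  rw [Finset.sum_comm]
  exact Finset.sum_congr rfl fun i _ => Finset.sum_congr rfl fun l _ => by ring

theorem constraintRow_dotProduct (i : Fin m) (t : ℝ) (z : Fin n → ℝ) :
    P.constraintRow i ⬝ᵥ (Fin.cons t z : Fin (n + 1) → ℝ) = t * P.b i - (P.A *ᵥ z) i := by
  simp [constraintRow, dotProduct, mulVec, Fin.sum_univ_succ]
  ring

theorem traceInner_Ahat_vecMulVec (t : ℝ) (z : Fin n → ℝ) :
    traceInner P.Ahat (vecMulVec (Fin.cons t z) (Fin.cons t z)) =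
      ∑ i, (t * P.b i - (P.A *ᵥ z) i) ^ 2 := by
  rw [traceInner_Ahat]
  refine Finset.sum_congr rfl fun i _ => ?_
  rw [vecMulVec_mulVec, dotProduct_comm _ (P.constraintRow i), constraintRow_dotProduct]
  simp [constraintRow_dotProduct]
  ring

theorem traceInner_Qhat_vecMulVec_one (x : Fin n → ℝ) :
    traceInner P.Qhat (vecMulVec (Fin.cons 1 x) (Fin.cons 1 x)) = P.obj x := by
  rw [Qhat, traceInner_bordered_vecMulVec, obj]
  ring

theorem mulVec_constraintRow_eq_zero {Y : Matrix (Fin (n + 1)) (Fin (n + 1)) ℝ}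
    (hY : Y.PosSemidef) (h : traceInner P.Ahat Y = 0) (i : Fin m) :
    Y *ᵥ P.constraintRow i = 0 := by
  rw [traceInner_Ahat, Finset.sum_eq_zero_iff_of_nonneg fun i _ => hY.dotProduct_nonneg _] at h
  exact (hY.dotProduct_mulVec_zero_iff _).1 (by simpa using h i (Finset.mem_univ i))

/-- If a nonnegative combination `a = Aᵀ y` of the constraint rows has `bᵀ y = 1`, then row `0` of
`Y` is the combination of the other rows with coefficients `a`. Hence `Y = L X Lᵀ` with `L ≥ 0` and
`X` of order `n`, so that complete positivity of `X` suffices. -/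
theorem mem_cpCone_of_dual_certificate (hn : n ≤ 4) {y : Fin m → ℝ} (hy : 0 ≤ P.Aᵀ *ᵥ y)
    (hb : P.b ⬝ᵥ y = 1) {Y : Matrix (Fin (n + 1)) (Fin (n + 1)) ℝ} (hY : Y ∈ dnnCone (n + 1))
    (h : traceInner P.Ahat Y = 0) : Y ∈ cpCone (n + 1) := by
  set a := P.Aᵀ *ᵥ y with ha
  have hu : ∑ i, y i • P.constraintRow i = (Fin.cons 1 (-a) : Fin (n + 1) → ℝ) := by
    ext k
    refine Fin.cases ?_ (fun k => ?_) k
    · simp [constraintRow, ← hb, dotProduct, mul_comm]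
    · simp [constraintRow, ha, mulVec, dotProduct, mul_comm]
  have hYu : Y *ᵥ (Fin.cons 1 (-a) : Fin (n + 1) → ℝ) = 0 := by
    rw [← hu, mulVec_sum]
    simp [mulVec_smul, P.mulVec_constraintRow_eq_zero hY.1 h]
  have hY0 : ∀ k, ∑ l, Y k (Fin.succ l) * a l = Y k 0 := fun k => by
    have := congrFun hYu k
    simp only [mulVec, dotProduct, Fin.sum_univ_succ, Fin.cons_zero, Fin.cons_succ, mul_one,
      Pi.neg_apply, mul_neg, Finset.sum_neg_distrib, Pi.zero_apply] at this
    linarith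
  set L : Matrix (Fin (n + 1)) (Fin n) ℝ :=
    of (Fin.cons a (1 : Matrix (Fin n) (Fin n) ℝ))
  have hL0 : ∀ j, L 0 j = a j := fun _ => rfl
  have hL1 : ∀ i j, L (Fin.succ i) j = (1 : Matrix (Fin n) (Fin n) ℝ) i j := fun _ _ => rfl
  have hLnn : ∀ i j, 0 ≤ L i j := fun i j => by
    refine Fin.cases ?_ (fun i => ?_) i
    · exact hy j
    · rcases eq_or_ne i j with rfl | hij
      · simp [hL1]
      · simp [hL1, hij]
  have hLY : ∀ k l, (L * Y.submatrix Fin.succ Fin.succ) k l = Y k l.succ := fun k l => by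
    refine Fin.cases ?_ (fun k => ?_) k
    · rw [hY.1.apply_comm, ← hY0, mul_apply]
      refine Finset.sum_congr rfl fun j _ => ?_
      rw [hY.1.apply_comm]
      simp [hL0, mul_comm]
    · simp [hL1, mul_apply, one_apply]
  have hfac : Y = L * Y.submatrix Fin.succ Fin.succ * Lᵀ := by
    ext k l
    rw [mul_apply]
    simp only [hLY]
    refine Fin.cases ?_ (fun l => ?_) l
    · simp [hL0, hY0]
    · simp [hL1, one_apply]
  rw [hfac]
  refine mul_mul_transpose_mem_cpCone (dnnCone_subset_cpCone hn ⟨hY.1.submatrix _, ?_⟩) hLnn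
  exact fun i j => hY.2 _ _

/-! ### The conic relaxation -/

/-- A feasible completely positive `Y` splits into a convex combination of lifted points of the
feasible region, from the generators with nonzero entry `0`, and lifted recession directions. The
latter do not contribute to row `0` of `Y`, and they do not decrease the objective. -/
theorem exists_convex_combination (hL : P.negCurvature = ∅)
    {Y : Matrix (Fin (n + 1)) (Fin (n + 1)) ℝ} (hY : Y ∈ cpCone (n + 1))
    (hA : traceInner P.Ahat Y = 0) (h00 : Y 0 0 = 1) :
    ∃ (k : ℕ) (w : Fin k → ℝ) (x : Fin k → Fin n → ℝ), (∀ j, 0 ≤ w j) ∧ ∑ j, w j = 1 ∧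
      (∀ j, w j ≠ 0 → x j ∈ P.feasible) ∧ (∀ i : Fin n, Y 0 i.succ = (∑ j, w j • x j) i) ∧
      ∑ j, w j * P.obj (x j) ≤ traceInner P.Qhat Y := by
  obtain ⟨k, y, hy, rfl⟩ := hY
  obtain ⟨t, z, rfl⟩ : ∃ (t : Fin k → ℝ) (z : Fin k → Fin n → ℝ),
      y = fun j => (Fin.cons (t j) (z j) : Fin (n + 1) → ℝ) :=
    ⟨fun j => y j 0, fun j => Fin.tail (y j), by simp⟩
  have ht : ∀ j, 0 ≤ t j := fun j => hy j 0
  have hz : ∀ j, 0 ≤ z j := fun j i => hy j i.succ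
  have hAz : ∀ j, P.A *ᵥ z j = t j • P.b := by
    intro j
    rw [traceInner_sum, Finset.sum_eq_zero_iff_of_nonneg] at hA
    · have h := hA j (Finset.mem_univ j)
      rw [traceInner_Ahat_vecMulVec, Finset.sum_eq_zero_iff_of_nonneg fun _ _ => sq_nonneg _] at h
      ext i
      have := pow_eq_zero_iff (two_ne_zero) |>.1 (h i (Finset.mem_univ i))
      simp only [Pi.smul_apply, smul_eq_mul]
      linarith
    · intro j _
      rw [traceInner_Ahat_vecMulVec]
      exact Finset.sum_nonneg fun _ _ => sq_nonneg _
  refine ⟨k, fun j => t j ^ 2, fun j => (t j)⁻¹ • z j, fun j => sq_nonneg _, ?_, fun j hj => ?_,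
    fun i => ?_, ?_⟩
  · simpa [Matrix.sum_apply, vecMulVec_apply, pow_two] using h00
  · have htj : t j ≠ 0 := fun h => hj (by simp [h])
    refine ⟨?_, smul_nonneg (inv_nonneg.2 (ht j)) (hz j)⟩
    rw [mulVec_smul, hAz, smul_smul, inv_mul_cancel₀ htj, one_smul]
  · rw [Finset.sum_apply, Matrix.sum_apply]
    refine Finset.sum_congr rfl fun j _ => ?_
    rcases eq_or_ne (t j) 0 with h | h
    · simp [vecMulVec_apply, h]
    · simp only [vecMulVec_apply, Fin.cons_zero, Fin.cons_succ, Pi.smul_apply, smul_eq_mul]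
      field_simp
  · rw [traceInner_sum]
    refine Finset.sum_le_sum fun j _ => ?_
    rw [Qhat, traceInner_bordered_vecMulVec]
    rcases eq_or_ne (t j) 0 with h | h
    · -- A recession direction of the feasible region, so its curvature is nonnegative.
      have hd : z j ∉ P.negCurvature := by simp [hL]
      have : 0 ≤ z j ⬝ᵥ (P.Q *ᵥ z j) := by
        by_contra! hneg
        exact hd ⟨by rw [hAz, h, zero_smul], hz j, hneg⟩
      simpa [h] using this
    · simp only [obj, mulVec_smul, dotProduct_smul, smul_dotProduct, smul_eq_mul]
      apply le_of_eq
      field_simp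
      ring

section

variable {P} {K : ConvexCone ℝ (Matrix (Fin (n + 1)) (Fin (n + 1)) ℝ)}

theorem vecMulVec_mem_relaxFeasibleAt (hK : cpCone (n + 1) ⊆ (K : Set _)) {x : Fin n → ℝ}
    (hx : x ∈ P.feasible) :
    vecMulVec (Fin.cons 1 x) (Fin.cons 1 x) ∈ P.relaxFeasibleAt K x := by
  have h0 : (0 : Fin (n + 1) → ℝ) ≤ Fin.cons 1 x := fun i => by
    refine Fin.cases ?_ (fun i => ?_) i
    · simp
    · simpa using hx.2 i
  refine ⟨⟨?_, by simp [vecMulVec_apply], hK (vecMulVec_mem_cpCone h0)⟩,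
    fun j => by simp [vecMulVec_apply]⟩
  rw [traceInner_Ahat_vecMulVec, hx.1]
  simp

theorem smul_add_smul_mem_relaxFeasibleAt {a b : ℝ} (ha : 0 < a) (hb : 0 < b) (hab : a + b = 1)
    {x y : Fin n → ℝ} {Y Z : Matrix (Fin (n + 1)) (Fin (n + 1)) ℝ}
    (hY : Y ∈ P.relaxFeasibleAt K x) (hZ : Z ∈ P.relaxFeasibleAt K y) :
    a • Y + b • Z ∈ P.relaxFeasibleAt K (a • x + b • y) := by
  obtain ⟨⟨hY1, hY2, hY3⟩, hY4⟩ := hY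
  obtain ⟨⟨hZ1, hZ2, hZ3⟩, hZ4⟩ := hZ
  refine ⟨⟨?_, ?_, K.add_mem (K.smul_mem ha hY3) (K.smul_mem hb hZ3)⟩, fun j => ?_⟩
  · simp [traceInner_add, traceInner_smul, hY1, hZ1]
  · simp [hY2, hZ2, hab]
  · simp [hY4, hZ4]

theorem relaxValAt_le_obj (hK : cpCone (n + 1) ⊆ (K : Set _)) {x : Fin n → ℝ}
    (hx : x ∈ P.feasible) : P.relaxValAt K x ≤ (P.obj x : EReal) := by
  rw [← traceInner_Qhat_vecMulVec_one]
  exact iInf₂_le _ (vecMulVec_mem_relaxFeasibleAt hK hx)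

theorem isConvexFun_relaxValAt : IsConvexFun (P.relaxValAt K) := by
  rw [IsConvexFun, convex_iff_forall_pos]
  rintro ⟨x, r⟩ hr ⟨y, s⟩ hs a b ha hb hab
  simp only [Set.mem_ofPred_eq] at hr hs
  change P.relaxValAt K (a • x + b • y) ≤ ((a * r + b * s : ℝ) : EReal)
  -- The infima may not be attained, so every real bound above the combined value is tested.
  refine EReal.le_of_forall_lt_iff_le.1 fun v hv => ?_
  have hv : a * r + b * s < v := by exact_mod_cast hv
  set e := v - (a * r + b * s) with he
  have hr' : P.relaxValAt K x < ((r + e : ℝ) : EReal) :=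
    hr.trans_lt (by exact_mod_cast (by linarith : r < r + e))
  have hs' : P.relaxValAt K y < ((s + e : ℝ) : EReal) :=
    hs.trans_lt (by exact_mod_cast (by linarith : s < s + e))
  simp only [relaxValAt, iInf_lt_iff] at hr' hs'
  obtain ⟨Y, hY, hYr⟩ := hr'
  obtain ⟨Z, hZ, hZs⟩ := hs'
  have hYr : traceInner P.Qhat Y < r + e := by exact_mod_cast hYr
  have hZs : traceInner P.Qhat Z < s + e := by exact_mod_cast hZs
  refine (iInf₂_le _ (smul_add_smul_mem_relaxFeasibleAt ha hb hab hY hZ)).trans ?_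
  rw [traceInner_add, traceInner_smul, traceInner_smul]
  have h1 := mul_lt_mul_of_pos_left hYr ha
  have h2 := mul_lt_mul_of_pos_left hZs hb
  have h3 : a * e + b * e = e := by rw [← add_mul, hab, one_mul]
  exact_mod_cast (by linarith : a * traceInner P.Qhat Y + b * traceInner P.Qhat Z ≤ v)

theorem relaxValAt_le_convexEnvelope (hK : cpCone (n + 1) ⊆ (K : Set _)) (x : Fin n → ℝ) :
    P.relaxValAt K x ≤ P.convexEnvelope x :=
  le_iSup₂ (f := fun g (_ : g ∈ {g | P.IsConvexUnderestimator g}) => g x) (P.relaxValAt K)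
    ⟨isConvexFun_relaxValAt, fun _ hx => relaxValAt_le_obj hK hx⟩

theorem relaxVal_le_optVal (hK : cpCone (n + 1) ⊆ (K : Set _)) : P.relaxVal K ≤ P.optVal := by
  refine le_iInf₂ fun x hx => ?_
  rw [← traceInner_Qhat_vecMulVec_one]
  exact iInf₂_le _ (vecMulVec_mem_relaxFeasibleAt hK hx).1

theorem relaxVal_le_relaxValAt (x : Fin n → ℝ) : P.relaxVal K ≤ P.relaxValAt K x :=
  le_iInf₂ fun Y hY => iInf₂_le Y hY.1

theorem convexEnvelope_le_relaxValAt (hL : P.negCurvature = ∅)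
    (hcp : P.relaxFeasible K ⊆ cpCone (n + 1)) (x : Fin n → ℝ) :
    P.convexEnvelope x ≤ P.relaxValAt K x := by
  refine iSup₂_le fun g hg => le_iInf₂ fun Y hY => ?_
  obtain ⟨k, w, z, hw, hw1, hz, hx, hle⟩ :=
    P.exists_convex_combination hL (hcp hY.1) hY.1.1 hY.1.2.1
  have hx' : x = ∑ j, w j • z j := funext fun i => (hY.2 i).symm.trans (hx i)
  have hmem := hg.1.finsum_mem (z := fun j => (z j, P.obj (z j))) hw
    (by rwa [finsum_eq_sum_of_fintype]) fun j hj => hg.2 _ (hz j hj)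
  rw [finsum_eq_sum_of_fintype] at hmem
  simp only [Set.mem_ofPred_eq, Prod.fst_sum, Prod.snd_sum, Prod.smul_fst, Prod.smul_snd, ← hx',
    smul_eq_mul] at hmem
  exact hmem.trans (by exact_mod_cast hle)

theorem optVal_le_relaxVal (hL : P.negCurvature = ∅)
    (hcp : P.relaxFeasible K ⊆ cpCone (n + 1)) : P.optVal ≤ P.relaxVal K := by
  -- The constant `optVal` is a convex underestimator.
  have hconst : P.IsConvexUnderestimator fun _ => P.optVal := by
    refine ⟨?_, fun x hx => iInf₂_le x hx⟩
    rw [IsConvexFun, convex_iff_forall_pos]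
    rintro ⟨x, r⟩ hr ⟨y, s⟩ hs a b ha hb hab
    change P.optVal ≤ ((a * r + b * s : ℝ) : EReal)
    simp only [Set.mem_ofPred_eq] at hr hs
    have hmin : P.optVal ≤ ((min r s : ℝ) : EReal) := by
      rcases min_choice r s with h | h <;> rwa [h]
    exact hmin.trans (by exact_mod_cast Convex.min_le_combo r s ha.le hb.le hab)
  refine le_iInf₂ fun Y hY => ?_
  have hYx : Y ∈ P.relaxFeasibleAt K fun j => Y 0 j.succ := ⟨hY, fun _ => rfl⟩
  calc P.optVal ≤ P.convexEnvelope fun j => Y 0 j.succ :=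
        le_iSup₂ (f := fun g (_ : g ∈ {g | P.IsConvexUnderestimator g}) => g fun j => Y 0 j.succ)
          (fun _ => P.optVal) hconst
    _ ≤ P.relaxValAt K fun j => Y 0 j.succ := convexEnvelope_le_relaxValAt hL hcp _
    _ ≤ _ := iInf₂_le Y hYx

theorem mem_convexHull_optSet (hL : P.negCurvature = ∅)
    (hcp : P.relaxFeasible K ⊆ cpCone (n + 1)) {x : Fin n → ℝ}
    {Y : Matrix (Fin (n + 1)) (Fin (n + 1)) ℝ} (hY : Y ∈ P.relaxFeasibleAt K x)
    (hval : (traceInner P.Qhat Y : EReal) = P.optVal) : x ∈ convexHull ℝ P.optSet := by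
  obtain ⟨k, w, z, hw, hw1, hz, hx, hle⟩ :=
    P.exists_convex_combination hL (hcp hY.1) hY.1.1 hY.1.2.1
  have hx' : x = ∑ j, w j • z j := funext fun i => (hY.2 i).symm.trans (hx i)
  set v := traceInner P.Qhat Y
  have hge : ∀ j, w j ≠ 0 → v ≤ P.obj (z j) := fun j hj => by
    have : (v : EReal) ≤ P.obj (z j) := hval ▸ iInf₂_le (z j) (hz j hj)
    exact_mod_cast this
  have hnn : ∀ j ∈ Finset.univ, 0 ≤ w j * (P.obj (z j) - v) := fun j _ => by
    rcases eq_or_ne (w j) 0 with h | h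
    · simp [h]
    · exact mul_nonneg (hw j) (sub_nonneg.2 (hge j h))
  have hsum : ∑ j, w j * (P.obj (z j) - v) = 0 := by
    refine le_antisymm ?_ (Finset.sum_nonneg hnn)
    simp only [mul_sub, Finset.sum_sub_distrib, ← Finset.sum_mul, hw1, one_mul]
    linarith
  have hopt : ∀ j, w j ≠ 0 → z j ∈ P.optSet := fun j hj => by
    have h := (Finset.sum_eq_zero_iff_of_nonneg hnn).1 hsum j (Finset.mem_univ j)
    have h' : P.obj (z j) = v := by
      rcases mul_eq_zero.1 h with h | h
      · exact absurd h hj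
      · linarith
    exact ⟨hz j hj, by rw [h', hval]⟩
  have hmem := (convex_convexHull ℝ P.optSet).finsum_mem (z := z) hw
    (by rwa [finsum_eq_sum_of_fintype]) fun j hj => subset_convexHull ℝ _ (hopt j hj)
  rwa [finsum_eq_sum_of_fintype, ← hx'] at hmem

theorem exists_relaxFeasibleAt_of_mem_convexHull (hK : cpCone (n + 1) ⊆ (K : Set _))
    {x : Fin n → ℝ} (hx : x ∈ convexHull ℝ P.optSet) :
    ∃ Y ∈ P.relaxFeasibleAt K x, (traceInner P.Qhat Y : EReal) = P.optVal := by
  obtain ⟨x₀, hx₀⟩ := convexHull_nonempty_iff.1 ⟨x, hx⟩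
  simp only [← hx₀.2, EReal.coe_eq_coe_iff]
  refine convexHull_min (t := {x | ∃ Y ∈ P.relaxFeasibleAt K x, traceInner P.Qhat Y = P.obj x₀})
    (fun y hy => ?_) ?_ hx
  · refine ⟨_, vecMulVec_mem_relaxFeasibleAt hK hy.1, ?_⟩
    rw [traceInner_Qhat_vecMulVec_one]
    exact_mod_cast hy.2.trans hx₀.2.symm
  · rw [convex_iff_forall_pos]
    rintro y ⟨Y, hY, hYv⟩ z ⟨Z, hZ, hZv⟩ a b ha hb hab
    refine ⟨_, smul_add_smul_mem_relaxFeasibleAt ha hb hab hY hZ, ?_⟩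
    rw [traceInner_add, traceInner_smul, traceInner_smul, hYv, hZv, ← add_mul, hab, one_mul]

end

end QP

theorem corollary5p3 (m n : ℕ) (P : QP m n)
    (hS : P.feasible.Nonempty) (hL : P.negCurvature = ∅)
    (K : ConvexCone ℝ (Matrix (Fin (n + 1)) (Fin (n + 1)) ℝ)) (hK : K ∈ coneFamilyStar n)
    (hn : n ≤ 3 ∨ (n = 4 ∧ ∃ y : Fin m → ℝ, 0 ≤ P.Aᵀ *ᵥ y ∧ P.b ⬝ᵥ y = 1)) :
    (∀ x ∈ P.feasible, P.relaxValAt K x = P.convexEnvelope x) ∧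
    P.relaxVal K = P.optVal ∧
    ∀ x : Fin n → ℝ,
      (P.relaxValAt K x = P.optVal ∧ P.RelaxAttainedAt K x) ↔
        x ∈ convexHull ℝ P.optSet := by
  obtain ⟨-, hcpK, hKdnn⟩ := hK
  have hcp : P.relaxFeasible K ⊆ cpCone (n + 1) := fun Y hY => by
    rcases hn with hn | ⟨hn, y, hy, hb⟩
    · exact dnnCone_subset_cpCone (by omega) (hKdnn hY.2.2)
    · exact P.mem_cpCone_of_dual_certificate hn.le hy hb (hKdnn hY.2.2) hY.1
  have hval : P.relaxVal K = P.optVal :=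
    (QP.relaxVal_le_optVal hcpK).antisymm (QP.optVal_le_relaxVal hL hcp)
  refine ⟨fun x _ => (QP.relaxValAt_le_convexEnvelope hcpK x).antisymm
    (QP.convexEnvelope_le_relaxValAt hL hcp x), hval, fun x => ⟨?_, fun hx => ?_⟩⟩
  · rintro ⟨hx, Y, hY, hYv⟩
    exact QP.mem_convexHull_optSet hL hcp hY (hYv.trans hx)
  · obtain ⟨Y, hY, hYv⟩ := QP.exists_relaxFeasibleAt_of_mem_convexHull hcpK hx
    have h : P.relaxValAt K x = P.optVal :=
      (hYv ▸ iInf₂_le Y hY : P.relaxValAt K x ≤ P.optVal).antisymm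
        (hval ▸ QP.relaxVal_le_relaxValAt x)
    exact ⟨h, Y, hY, hYv.trans h.symm⟩
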